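/- Corollary 12.2. Let $(R,\mathfrak m)$ be a Noetherian commutative local ring of depth at least $3$. Let $r_0,r_1,r_2,r_3\ge 0$ be integers, and put $f_0=r_0+r_1$, $f_1=r_1+r_2$, $f_2=r_2+r_3$, $f_3=r_3$. Assume that the format $(f_0,f_1,f_2,f_3)$ has Euler characteristic zero, i.e. $f_0-f_1+f_2-f_3=0$ (equivalently $r_0=0$), that $f_0>0$, and that $r_2>1$. Then there exists a complex of free $R$-modules $$0\to R^{f_3}\xrightarrow{d_3}R^{f_2}\xrightarrow{d_2}R^{f_1}\xrightarrow{d_1}R^{f_0}$$ which is of this format (for $i=1,2,3$ the largest size of a nonvanishing minor of the matrix $d_i$ is $r_i$), is acyclic (exact at $R^{f_1}$, $R^{f_2}$ and $R^{f_3}$), and is minimal (all entries of $d_1,d_2,d_3$ lie in $\mathfrak m$). -/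

import Mathlib

/-- The depth of a (Noetherian) local ring: the supremum of the lengths of the regular sequences
of elements of its maximal ideal. -/
noncomputable def localDepth (R : Type*) [CommRing R] [IsLocalRing R] : ℕ∞ :=
  ⨆ rs ∈ {rs : List R | (∀ x ∈ rs, x ∈ IsLocalRing.maximalIdeal R) ∧
    RingTheory.Sequence.IsRegular R rs}, (rs.length : ℕ∞)

/-- `HasMinorRank A r`: the largest size of a nonvanishing minor of the matrix `A` is `r`. -/
def HasMinorRank {R : Type*} [CommRing R] {m n : ℕ} (A : Matrix (Fin m) (Fin n) R) (r : ℕ) : Prop :=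
  IsGreatest {k : ℕ | ∃ (a : Fin k ↪ Fin m) (b : Fin k ↪ Fin n), (A.submatrix a b).det ≠ 0} r

/-- A (valid) format of complexes `0 → F₃ → F₂ → F₁ → F₀`. It is given by the numbers
`r₀, r₁, r₂, r₃`; the ranks of the free modules are `fᵢ = rᵢ + rᵢ₊₁`, where `r₄ = 0`. -/
structure Format where
  r₀ : ℕ
  r₁ : ℕ
  r₂ : ℕ
  r₃ : ℕ

namespace Format

/-- The rank of `F₀`. -/
def f₀ (φ : Format) : ℕ := φ.r₀ + φ.r₁

/-- The rank of `F₁`. -/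
def f₁ (φ : Format) : ℕ := φ.r₁ + φ.r₂

/-- The rank of `F₂`. -/
def f₂ (φ : Format) : ℕ := φ.r₂ + φ.r₃

/-- The rank of `F₃`. -/
def f₃ (φ : Format) : ℕ := φ.r₃

/-- The Euler characteristic `f₀ - f₁ + f₂ - f₃` of a format. -/
def eulerChar (φ : Format) : ℤ := φ.f₀ - φ.f₁ + φ.f₂ - φ.f₃

end Format

/-- A complex `0 → R^{n₃} → R^{n₂} → R^{n₁} → R^{n₀}` of free `R`-modules, with its differentials
written as matrices acting on column vectors. -/
structure FreeComplex (R : Type*) [CommRing R] (n₀ n₁ n₂ n₃ : ℕ) where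
  d₁ : Matrix (Fin n₀) (Fin n₁) R
  d₂ : Matrix (Fin n₁) (Fin n₂) R
  d₃ : Matrix (Fin n₂) (Fin n₃) R
  d₁_mul_d₂ : d₁ * d₂ = 0
  d₂_mul_d₃ : d₂ * d₃ = 0

namespace FreeComplex

/-- The complex is of format `φ`: its modules have ranks `f₀, …, f₃` (this is in the type) and its
differentials `d₁, d₂, d₃` have ranks `r₁, r₂, r₃`. -/
structure HasFormat {R : Type*} [CommRing R] (φ : Format)
    (F : FreeComplex R φ.f₀ φ.f₁ φ.f₂ φ.f₃) : Prop where
  rank_d₁ : HasMinorRank F.d₁ φ.r₁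
  rank_d₂ : HasMinorRank F.d₂ φ.r₂
  rank_d₃ : HasMinorRank F.d₃ φ.r₃

/-- The complex is acyclic: its homology vanishes in the degrees `1, 2, 3`. -/
structure IsAcyclic {R : Type*} [CommRing R] {n₀ n₁ n₂ n₃ : ℕ}
    (F : FreeComplex R n₀ n₁ n₂ n₃) : Prop where
  exact₁ : Function.Exact F.d₂.mulVecLin F.d₁.mulVecLin
  exact₂ : Function.Exact F.d₃.mulVecLin F.d₂.mulVecLin
  exact₃ : Function.Injective F.d₃.mulVecLin

/-- The complex over a local ring is minimal: all entries of its differentials lie in the maximal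
ideal. -/
structure IsMinimal {R : Type*} [CommRing R] [IsLocalRing R] {n₀ n₁ n₂ n₃ : ℕ}
    (F : FreeComplex R n₀ n₁ n₂ n₃) : Prop where
  min_d₁ : ∀ i j, F.d₁ i j ∈ IsLocalRing.maximalIdeal R
  min_d₂ : ∀ i j, F.d₂ i j ∈ IsLocalRing.maximalIdeal R
  min_d₃ : ∀ i j, F.d₃ i j ∈ IsLocalRing.maximalIdeal R

end FreeComplex

/-!
Since the Euler characteristic of the format is `r₀`, the ranks to be realized are those of
`0 → R^{r₃} → R^{r₂ + r₃} → R^{r₁ + r₂} → R^{r₁}` with `r₁ ≥ 1` and `r₂ ≥ 2`. Let `z, y, x` be a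
regular sequence in the maximal ideal; its order does not matter, as `R` is local and Noetherian.

The essential case is `r₁ = 1`, `r₂ = 2`, `r₃ = n ≥ 1`: a resolution of a cyclic module with three
relations whose last Betti number is arbitrary (`isMinimalResolution_base`). Here `d₃` is
multiplication by `q = x + y t + z t²` from the polynomials in `t` of degree less than `n` to those
of degree less than `n + 2`. The functionals that vanish on the multiples of `q` are the solutions
of the linear recurrence `x sᵢ + y sᵢ₊₁ + z sᵢ₊₂ = 0`, and the rows of `d₂` are three of them:
`seqA` and `seqB`, which start with `zⁿ, 0` and `0, zⁿ`, and `seqC`, which ends with `xⁿ, 0`. A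
solution is determined by its first two terms, so there is one relation `d₁` between the three.
If `seqA` and `seqB` vanish on `P`, then `z` divides its top coefficient, because modulo `z` only
the last term of `seqB` survives, and it is a power of `-y`; subtracting a multiple of `q` and
inducting on `n` gives exactness at `F₂` (`exists_eq_quad_mul`). Exactness at `F₁` says that a
linear polynomial on which `seqC` is divisible by `zⁿ` lies in the ideal `(q, zⁿ)`. This goes by
induction on the power of `z`, as modulo `z` the functional `seqC` is evaluation of the
homogenized polynomial at the root `(x, -y)` of `x + y t`
(`exists_eq_quad_mul_add_of_pow_dvd`).

The other formats follow by two operations. Replacing an ideal `I` by `y I + (h)`, where `h` is a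
power of `z` in `𝔪 I`, raises `r₂` by one (`IsMinimalResolution.cone`); starting from `I = (z)` it
also gives the case `r₃ = 0`. Adding the complex `R → R`, multiplication by `z`, as a direct summand
raises `r₁` by one (`IsMinimalResolution.directSum`).

The ranks are read off from minors that are nonzerodivisors, which are carried along. For `d₁` and
`d₃` these minors have the largest possible size. For `d₂` larger minors vanish because
`d₁ * d₂ = 0` and `d₁` is split surjective up to a nonzerodivisor
(`card_le_of_det_submatrix_ne_zero`).
-/

open Polynomial Matrix IsLocalRing
open scoped nonZeroDivisors

/-! ### Regular sequences of length three -/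

/-- The elements `z, y, x` form a weakly regular sequence, and so do `y, z`, with the
nonzerodivisor conditions written out in terms of elements of the ring. -/
structure IsRegularTriple {R : Type*} [CommRing R] (z y x : R) : Prop where
  z_regular : ∀ a, z * a = 0 → a = 0
  y_regular_mod_z : ∀ a, z ∣ y * a → z ∣ a
  x_regular_mod_zy : ∀ a b c, x * a = z * b + y * c → ∃ b' c', a = z * b' + y * c'
  y_regular : ∀ a, y * a = 0 → a = 0
  z_regular_mod_y : ∀ a, y ∣ z * a → y ∣ a

section RegularTriple

variable {R : Type*} [CommRing R]

theorem isSMulRegular_quotient_iff (I : Ideal R) (r : R) :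
    IsSMulRegular (R ⧸ (I • ⊤ : Submodule R R)) r ↔ ∀ a, r * a ∈ I → a ∈ I := by
  rw [isSMulRegular_iff_right_eq_zero_of_smul]
  have hI : (I • ⊤ : Submodule R R) = I := by simp
  rw [hI]
  constructor
  · intro h a ha
    rw [← Submodule.Quotient.mk_eq_zero]
    apply h
    rw [← Submodule.Quotient.mk_smul, Submodule.Quotient.mk_eq_zero]
    exact ha
  · intro h m
    obtain ⟨a, rfl⟩ := Submodule.Quotient.mk_surjective _ m
    rw [← Submodule.Quotient.mk_smul, Submodule.Quotient.mk_eq_zero,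
      Submodule.Quotient.mk_eq_zero]
    exact h a

theorem exists_isRegularTriple [IsLocalRing R] [IsNoetherianRing R] (hdepth : 3 ≤ localDepth R) :
    ∃ z y x : R, z ∈ maximalIdeal R ∧ y ∈ maximalIdeal R ∧ x ∈ maximalIdeal R ∧
      IsRegularTriple z y x := by
  obtain ⟨rs, hm, hreg, hlen⟩ : ∃ rs : List R, (∀ r ∈ rs, r ∈ maximalIdeal R) ∧
      RingTheory.Sequence.IsRegular R rs ∧ 3 ≤ rs.length := by
    by_contra! hcon
    have : localDepth R ≤ 2 := by
      refine iSup₂_le fun rs hrs => ?_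
      have := hcon rs hrs.1 hrs.2
      exact_mod_cast Nat.lt_succ_iff.1 this
    exact absurd (hdepth.trans this) (by decide)
  obtain ⟨z, y, x, t, rfl⟩ : ∃ z y x t, rs = z :: y :: x :: t := by
    match rs, hlen with
    | z :: y :: x :: t, _ => exact ⟨z, y, x, t, rfl⟩
  have hperm := IsLocalRing.isRegular_of_perm hreg (List.Perm.swap y z (x :: t))
  have h0 := (isSMulRegular_quotient_iff _ _).1 (hreg.regular_mod_prev 0 (by simp))
  have h1 := (isSMulRegular_quotient_iff _ _).1 (hreg.regular_mod_prev 1 (by simp))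
  have h2 := (isSMulRegular_quotient_iff _ _).1 (hreg.regular_mod_prev 2 (by simp))
  have h0' := (isSMulRegular_quotient_iff _ _).1 (hperm.regular_mod_prev 0 (by simp))
  have h1' := (isSMulRegular_quotient_iff _ _).1 (hperm.regular_mod_prev 1 (by simp))
  simp only [List.take_zero, Ideal.ofList_nil, List.getElem_cons_zero, Ideal.mem_bot] at h0 h0'
  simp only [List.take_succ_cons, List.take_zero, Ideal.ofList_singleton, List.getElem_cons_succ,
    List.getElem_cons_zero, Ideal.mem_span_singleton] at h1 h1'
  simp only [List.take_succ_cons, List.take_zero, Ideal.ofList_cons, Ideal.ofList_nil,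
    List.getElem_cons_succ, List.getElem_cons_zero, sup_bot_eq, ← Ideal.span_insert,
    Ideal.mem_span_pair] at h2
  refine ⟨z, y, x, hm _ (by simp), hm _ (by simp), hm _ (by simp), h0, h1, ?_, h0', h1'⟩
  intro a b c h
  obtain ⟨b', c', h'⟩ := h2 a ⟨b, c, by rw [h]; ring⟩
  exact ⟨b', c', by rw [← h']; ring⟩

end RegularTriple

/-! ### Recurrence sequences and multiples of a quadratic polynomial -/

section BaseSequences

variable {R : Type*} [CommRing R] (z y x : R)

/-- The solution `0, 1, -y, y² - xz, …` of the recurrence `v (k + 2) = -y v (k + 1) - x z v k`. -/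
def recSeq : ℕ → R
  | 0 => 0
  | 1 => 1
  | k + 2 => -y * recSeq (k + 1) - x * z * recSeq k

/-- The solution of `x s i + y s (i + 1) + z s (i + 2) = 0`, `i < n`, that starts with
`z ^ n, 0`. -/
def seqA (n : ℕ) : ℕ → R
  | 0 => z ^ n
  | i + 1 => -(x * z ^ (n - i) * recSeq z y x i)

/-- The solution of `x s i + y s (i + 1) + z s (i + 2) = 0`, `i < n`, that starts with
`0, z ^ n`. -/
def seqB (n i : ℕ) : R := z ^ (n + 1 - i) * recSeq z y x i

/-- The solution of `x s i + y s (i + 1) + z s (i + 2) = 0`, `i < n`, that ends with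
`x ^ n, 0` in the positions `n, n + 1`. -/
def seqC (n i : ℕ) : R := x ^ i * recSeq z y x (n + 1 - i)

/-- The polynomial `x + y t + z t²`. -/
noncomputable def quad : R[X] := C x + C y * X + C z * X ^ 2

/-- The functional that sends a polynomial `P` of degree at most `n + 1` to `∑ i, s i * Pᵢ`. -/
noncomputable def pairing (n : ℕ) (s : ℕ → R) : R[X] →ₗ[R] R :=
  ∑ i ∈ Finset.range (n + 2), s i • lcoeff R i

variable {z y x}

theorem pairing_apply (n : ℕ) (s : ℕ → R) (P : R[X]) :
    pairing n s P = ∑ i ∈ Finset.range (n + 2), s i * P.coeff i := by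
  simp [pairing]

theorem pairing_C_mul (n : ℕ) (s : ℕ → R) (a : R) (P : R[X]) :
    pairing n s (C a * P) = a * pairing n s P := by
  rw [← smul_eq_C_mul, map_smul, smul_eq_mul]

theorem pairing_X_pow {n : ℕ} (s : ℕ → R) {i : ℕ} (hi : i < n + 2) :
    pairing n s (X ^ i) = s i := by
  simp [pairing_apply, coeff_X_pow, hi]

theorem pairing_quad_mul_X_pow {n : ℕ} {s : ℕ → R}
    (hs : ∀ i < n, x * s i + y * s (i + 1) + z * s (i + 2) = 0) {j : ℕ} (hj : j < n) :
    pairing n s (quad z y x * X ^ j) = 0 := by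
  have : quad z y x * X ^ j = C x * X ^ j + C y * X ^ (j + 1) + C z * X ^ (j + 2) := by
    rw [quad]; ring
  rw [this, map_add, map_add, pairing_C_mul, pairing_C_mul, pairing_C_mul,
    pairing_X_pow _ (by omega), pairing_X_pow _ (by omega), pairing_X_pow _ (by omega), hs j hj]

theorem eq_sum_of_degree_lt {n : ℕ} {w : R[X]} (hw : w.degree < n) :
    w = ∑ j ∈ Finset.range n, C (w.coeff j) * X ^ j := by
  ext i
  simp only [finsetSum_coeff, coeff_C_mul, coeff_X_pow, mul_ite, mul_one, mul_zero,
    Finset.sum_ite_eq, Finset.mem_range]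
  split_ifs with h
  · rfl
  · exact coeff_eq_zero_of_degree_lt (hw.trans_le (by exact_mod_cast not_lt.1 h))

theorem pairing_quad_mul {n : ℕ} {s : ℕ → R}
    (hs : ∀ i < n, x * s i + y * s (i + 1) + z * s (i + 2) = 0) {w : R[X]} (hw : w.degree < n) :
    pairing n s (quad z y x * w) = 0 := by
  rw [eq_sum_of_degree_lt hw, Finset.mul_sum, map_sum]
  refine Finset.sum_eq_zero fun j hj => ?_
  rw [mul_left_comm, pairing_C_mul, pairing_quad_mul_X_pow hs (Finset.mem_range.1 hj), mul_zero]

theorem seqA_rec (n : ℕ) : ∀ i < n,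
    x * seqA z y x n i + y * seqA z y x n (i + 1) + z * seqA z y x n (i + 2) = 0
  | 0, h => by
    obtain ⟨m, rfl⟩ : ∃ m, n = m + 1 := ⟨n - 1, by omega⟩
    simp [seqA, recSeq]; ring
  | i + 1, h => by
    obtain ⟨m, rfl⟩ : ∃ m, n = i + m + 2 := ⟨n - i - 2, by omega⟩
    have h1 : i + m + 2 - i = m + 2 := by omega
    have h2 : i + m + 2 - (i + 1) = m + 1 := by omega
    have h3 : i + m + 2 - (i + 2) = m := by omega
    simp only [seqA, recSeq, h1, h2, h3]; ring

theorem seqB_rec (n i : ℕ) (h : i < n) :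
    x * seqB z y x n i + y * seqB z y x n (i + 1) + z * seqB z y x n (i + 2) = 0 := by
  obtain ⟨m, rfl⟩ : ∃ m, n = i + m + 1 := ⟨n - i - 1, by omega⟩
  have h1 : i + m + 1 + 1 - i = m + 2 := by omega
  have h2 : i + m + 1 + 1 - (i + 1) = m + 1 := by omega
  have h3 : i + m + 1 + 1 - (i + 2) = m := by omega
  simp only [seqB, recSeq, h1, h2, h3]; ring

theorem seqC_rec (n i : ℕ) (h : i < n) :
    x * seqC z y x n i + y * seqC z y x n (i + 1) + z * seqC z y x n (i + 2) = 0 := by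
  obtain ⟨m, rfl⟩ : ∃ m, n = i + m + 1 := ⟨n - i - 1, by omega⟩
  have h1 : i + m + 1 + 1 - i = m + 2 := by omega
  have h2 : i + m + 1 + 1 - (i + 1) = m + 1 := by omega
  have h3 : i + m + 1 + 1 - (i + 2) = m := by omega
  simp only [seqC, recSeq, h1, h2, h3]; ring

/-- Modulo `z`, the sequence `recSeq` is the geometric sequence with ratio `-y`. -/
theorem dvd_recSeq_sub (k : ℕ) : z ∣ recSeq z y x (k + 1) - (-y) ^ k := by
  induction k with
  | zero => simp [recSeq]
  | succ k ih =>
    obtain ⟨e, he⟩ := ih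
    refine ⟨-y * e - x * recSeq z y x k, ?_⟩
    rw [recSeq, sub_eq_iff_eq_add.1 he]; ring

/-- Both sides solve the same recurrence and agree in the first two places. -/
theorem pow_mul_seqC (h : ∀ a, z * a = 0 → a = 0) (n : ℕ) : ∀ i < n + 2,
    z ^ n * seqC z y x n i =
      recSeq z y x (n + 1) * seqA z y x n i + x * recSeq z y x n * seqB z y x n i
  | 0, _ => by simp [seqC, seqA, seqB, recSeq]; ring
  | 1, _ => by simp [seqC, seqA, seqB, recSeq]; ring
  | i + 2, hi => by
    have h0 := pow_mul_seqC h n i (by omega)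
    have h1 := pow_mul_seqC h n (i + 1) (by omega)
    have hA := seqA_rec (z := z) (y := y) (x := x) n i (by omega)
    have hB := seqB_rec (z := z) (y := y) (x := x) n i (by omega)
    have hC := seqC_rec (z := z) (y := y) (x := x) n i (by omega)
    rw [← sub_eq_zero]
    apply h
    linear_combination z ^ n * hC - recSeq z y x (n + 1) * hA - x * recSeq z y x n * hB
      - x * h0 - y * h1

theorem IsRegularTriple.dvd_of_dvd_neg_y_pow_mul (H : IsRegularTriple z y x) (k : ℕ) :
    ∀ a, z ∣ (-y) ^ k * a → z ∣ a := by
  induction k with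
  | zero => simp
  | succ k ih =>
    intro a h
    apply ih
    apply H.y_regular_mod_z
    rw [← dvd_neg]
    convert h using 1; ring

theorem IsRegularTriple.x_pow_regular_mod_zy (H : IsRegularTriple z y x) (k : ℕ) :
    ∀ a b c, x ^ k * a = z * b + y * c → ∃ b' c', a = z * b' + y * c' := by
  induction k with
  | zero => exact fun a b c h => ⟨b, c, by simpa using h⟩
  | succ k ih =>
    intro a b c h
    obtain ⟨b', c', h'⟩ := H.x_regular_mod_zy (x ^ k * a) b c (by rw [← h]; ring)
    exact ih a b' c' h'

/-- Exactness of the base complex at `F₂`. The pairing with `seqB` forces the top coefficient of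
`P` to be divisible by `z`, so that a multiple of `quad` can be split off. -/
theorem exists_eq_quad_mul (H : IsRegularTriple z y x) (n : ℕ) (P : R[X])
    (hP : P.degree < (n + 2 : ℕ)) (hA : pairing n (seqA z y x n) P = 0)
    (hB : pairing n (seqB z y x n) P = 0) : ∃ w : R[X], w.degree < n ∧ P = quad z y x * w := by
  induction n generalizing P with
  | zero =>
    refine ⟨0, by simp, ?_⟩
    rw [pairing_apply, Finset.sum_range_succ, Finset.sum_range_one] at hA hB
    simp only [seqA, seqB, recSeq, pow_zero, mul_zero, neg_zero, zero_mul, add_zero, zero_add,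
      one_mul, Nat.sub_self] at hA hB
    rw [eq_sum_of_degree_lt hP, Finset.sum_range_succ, Finset.sum_range_one, hA, hB]
    simp
  | succ n ih =>
    have hdvd : z ∣ P.coeff (n + 2) := by
      apply H.dvd_of_dvd_neg_y_pow_mul (n + 1)
      obtain ⟨e, he⟩ := dvd_recSeq_sub (z := z) (y := y) (x := x) (n + 1)
      have hsum : z ∣ ∑ i ∈ Finset.range (n + 2), seqB z y x (n + 1) i * P.coeff i := by
        refine Finset.dvd_sum fun i hi => ?_
        have : n + 1 + 1 - i = (n + 1 - i) + 1 := by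
          have := Finset.mem_range.1 hi; omega
        rw [seqB, this, pow_succ]
        exact ⟨z ^ (n + 1 - i) * recSeq z y x i * P.coeff i, by ring⟩
      rw [pairing_apply, Finset.sum_range_succ] at hB
      have hlast : seqB z y x (n + 1) (n + 2) = (-y) ^ (n + 1) + z * e := by
        rw [seqB, ← he]; simp
      rw [hlast] at hB
      obtain ⟨f, hf⟩ := hsum
      exact ⟨-f - e * P.coeff (n + 2), by linear_combination hB - hf⟩
    obtain ⟨a, ha⟩ := hdvd
    set P' := P - quad z y x * (C a * X ^ n) with hP'
    have hP'' : P' = P - (C (x * a) * X ^ n + C (y * a) * X ^ (n + 1) + C (z * a) * X ^ (n + 2)) := by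
      rw [hP', quad]; simp only [C_mul]; ring
    have hdeg : P'.degree < (n + 2 : ℕ) := by
      rw [degree_lt_iff_coeff_zero] at hP ⊢
      intro m hm
      rw [hP'']
      rcases hm.eq_or_lt with rfl | hm
      · simp [-map_mul, coeff_C_mul, coeff_X_pow, ha]
      · rw [coeff_sub, hP m (by omega)]
        have h1 : m ≠ n := by omega
        have h2 : m ≠ n + 1 := by omega
        have h3 : m ≠ n + 2 := by omega
        simp [-map_mul, coeff_C_mul, coeff_X_pow, h1, h2, h3]
    have hq : ∀ s : ℕ → R, (∀ i < n + 1, x * s i + y * s (i + 1) + z * s (i + 2) = 0) →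
        pairing (n + 1) s P = 0 → pairing (n + 1) s P' = 0 := by
      intro s hs h
      rw [hP', map_sub, h, mul_left_comm, pairing_C_mul, pairing_quad_mul_X_pow hs (by omega)]
      simp
    have hcut : ∀ s s' : ℕ → R, (∀ i < n + 2, s i = z * s' i) →
        pairing (n + 1) s P' = 0 → pairing n s' P' = 0 := by
      intro s s' hss h
      apply H.z_regular
      rw [← h, pairing_apply, pairing_apply, Finset.sum_range_succ _ (n + 2),
        coeff_eq_zero_of_degree_lt hdeg, mul_zero, add_zero, Finset.mul_sum]
      refine Finset.sum_congr rfl fun i hi => ?_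
      rw [hss i (Finset.mem_range.1 hi)]; ring
    obtain ⟨w, hw, hPw⟩ := ih P' hdeg
      (hcut _ _ (by
        rintro (_ | i) hi
        · simp [seqA]; ring
        · have : n + 1 - i = (n - i) + 1 := by omega
          simp only [seqA, this]; ring) (hq _ (seqA_rec _) hA))
      (hcut _ _ (by
        intro i hi
        have : n + 1 + 1 - i = (n + 1 - i) + 1 := by omega
        simp only [seqB, this]; ring) (hq _ (seqB_rec _) hB))
    refine ⟨w + C a * X ^ n, ?_, ?_⟩
    · refine (degree_add_le _ _).trans_lt (max_lt (hw.trans ?_) ?_)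
      · exact_mod_cast Nat.lt_succ_self n
      · refine (degree_C_mul_X_pow_le _ _).trans_lt ?_
        exact_mod_cast Nat.lt_succ_self n
    · rw [mul_add, ← hPw, hP']; ring

/-- Modulo `z`, the pairing with `seqC` is, up to a power of the regular element `-y`, the
homogenization of `P` evaluated at `(x, -y)`. -/
theorem dvd_homogenization_of_dvd_pairing_seqC (H : IsRegularTriple z y x) {n k : ℕ} (hk : k ≤ n)
    (P : R[X]) (hP : P.degree < (k + 1 : ℕ)) (hC : z ∣ pairing n (seqC z y x n) P) :
    z ∣ ∑ i ∈ Finset.range (k + 1), x ^ i * (-y) ^ (k - i) * P.coeff i := by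
  apply H.dvd_of_dvd_neg_y_pow_mul (n - k)
  rw [← dvd_sub_right hC, pairing_apply]
  have hsub : ∑ i ∈ Finset.range (n + 2), seqC z y x n i * P.coeff i =
      ∑ i ∈ Finset.range (k + 1), seqC z y x n i * P.coeff i := by
    symm
    refine Finset.sum_subset (Finset.range_mono (by omega)) fun i _ hi => ?_
    rw [degree_lt_iff_coeff_zero] at hP
    rw [hP i (by simpa using hi), mul_zero]
  rw [hsub, Finset.mul_sum, ← Finset.sum_sub_distrib]
  refine Finset.dvd_sum fun i hi => ?_
  have hik : i < k + 1 := Finset.mem_range.1 hi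
  obtain ⟨e, he⟩ := dvd_recSeq_sub (z := z) (y := y) (x := x) (n - i)
  have h1 : n + 1 - i = n - i + 1 := by omega
  have h2 : (-y) ^ (n - i) = (-y) ^ (n - k) * (-y) ^ (k - i) := by
    rw [← pow_add]; congr 1; omega
  refine ⟨x ^ i * e * P.coeff i, ?_⟩
  rw [seqC, h1, sub_eq_iff_eq_add.1 he, h2]; ring

/-- If the pairing of `P` with `seqC` vanishes modulo `z`, then `P` is modulo `z` a multiple of
`x + y t`: its homogenization has the zero `(x, -y)`. -/
theorem exists_eq_quad_mul_add_of_dvd (H : IsRegularTriple z y x) {n k : ℕ} (hk : k ≤ n)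
    (P : R[X]) (hP : P.degree < (k + 1 : ℕ)) (hC : z ∣ pairing n (seqC z y x n) P) :
    ∃ w P' : R[X], w.degree < k ∧ P'.degree < (k + 2 : ℕ) ∧ P = quad z y x * w + C z * P' := by
  induction k generalizing P with
  | zero =>
    obtain ⟨b, hb⟩ := dvd_homogenization_of_dvd_pairing_seqC H hk P hP hC
    refine ⟨0, C b, by simp, degree_C_le.trans_lt (by simp), ?_⟩
    rw [eq_sum_of_degree_lt hP]
    simp only [zero_add, Finset.range_one, Finset.sum_singleton, pow_zero, Nat.sub_self, one_mul]
      at hb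
    simp [hb]
  | succ k ih =>
    obtain ⟨b, c, hbc⟩ : ∃ b c, P.coeff (k + 1) = z * b + y * c := by
      obtain ⟨e, he⟩ := dvd_homogenization_of_dvd_pairing_seqC H hk P hP hC
      rw [Finset.sum_range_succ] at he
      have hy : y ∣ ∑ i ∈ Finset.range (k + 1), x ^ i * (-y) ^ (k + 1 - i) * P.coeff i := by
        refine Finset.dvd_sum fun i hi => ?_
        have : k + 1 - i = (k - i) + 1 := by
          have := Finset.mem_range.1 hi; omega
        rw [this]
        exact ⟨-(x ^ i * (-y) ^ (k - i) * P.coeff i), by ring⟩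
      obtain ⟨f, hf⟩ := hy
      refine H.x_pow_regular_mod_zy (k + 1) _ e (-f) ?_
      rw [hf, Nat.sub_self] at he
      linear_combination he
    set P₁ := P - quad z y x * (C c * X ^ k) - C z * (C b * X ^ (k + 1) - C c * X ^ (k + 2))
      with hP₁
    have hP₁' : P₁ = P - (C (x * c) * X ^ k + C (z * b + y * c) * X ^ (k + 1)) := by
      rw [hP₁, quad]; simp only [C_mul, C_add]; ring
    have hdeg : P₁.degree < (k + 1 : ℕ) := by
      rw [degree_lt_iff_coeff_zero] at hP ⊢
      intro m hm
      rw [hP₁']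
      rcases hm.eq_or_lt with rfl | hm
      · simp [-map_mul, -map_add, coeff_C_mul, coeff_X_pow, hbc]
      · rw [coeff_sub, hP m (by omega)]
        have h1 : m ≠ k := by omega
        have h2 : m ≠ k + 1 := by omega
        simp [-map_mul, -map_add, coeff_C_mul, coeff_X_pow, h1, h2]
    have hC₁ : z ∣ pairing n (seqC z y x n) P₁ := by
      rw [hP₁, map_sub, map_sub, mul_left_comm, pairing_C_mul,
        pairing_quad_mul_X_pow (seqC_rec n) (by omega), pairing_C_mul, mul_zero, sub_zero]
      exact dvd_sub hC (dvd_mul_right _ _)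
    obtain ⟨w, P', hw, hP', h⟩ := ih (by omega) P₁ hdeg hC₁
    refine ⟨w + C c * X ^ k, P' + (C b * X ^ (k + 1) - C c * X ^ (k + 2)), ?_, ?_, ?_⟩
    · refine (degree_add_le _ _).trans_lt (max_lt (hw.trans ?_) ?_)
      · exact_mod_cast Nat.lt_succ_self k
      · refine (degree_C_mul_X_pow_le _ _).trans_lt ?_
        exact_mod_cast Nat.lt_succ_self k
    · refine (degree_add_le _ _).trans_lt (max_lt (hP'.trans ?_)
        ((degree_sub_le _ _).trans_lt (max_lt ?_ ?_)))
      · exact_mod_cast Nat.lt_succ_self _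
      · refine (degree_C_mul_X_pow_le _ _).trans_lt ?_
        exact_mod_cast (by omega : k + 1 < k + 1 + 2)
      · refine (degree_C_mul_X_pow_le _ _).trans_lt ?_
        exact_mod_cast (by omega : k + 2 < k + 1 + 2)
    · rw [mul_add, mul_add, ← sub_eq_zero]
      rw [hP₁] at h
      linear_combination h

/-- Exactness of the base complex at `F₁`: a polynomial `P` on which the pairing with `seqC` is
divisible by a power of `z` lies in the ideal generated by `quad` and that power of `z`. -/
theorem exists_eq_quad_mul_add_of_pow_dvd (H : IsRegularTriple z y x) {n m : ℕ} (hm : m ≤ n)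
    (P : R[X]) (hP : P.degree < (n + 2 - m : ℕ)) (hC : z ^ m ∣ pairing n (seqC z y x n) P) :
    ∃ w P' : R[X], w.degree < n ∧ P'.degree < (n + 2 : ℕ) ∧
      P = quad z y x * w + C (z ^ m) * P' := by
  induction m generalizing P with
  | zero => exact ⟨0, P, by simp, hP, by simp⟩
  | succ m ih =>
    have h1 : n + 2 - (m + 1) = n - m + 1 := by omega
    have h2 : n + 2 - m = n - m + 2 := by omega
    rw [h1] at hP
    obtain ⟨w, P₁, hw, hP₁, h⟩ := exists_eq_quad_mul_add_of_dvd H (Nat.sub_le n m) P hP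
      ((dvd_pow_self z (Nat.succ_ne_zero m)).trans hC)
    have hw' : w.degree < n := hw.trans_le (by exact_mod_cast Nat.sub_le n m)
    have hC₁ : z ^ m ∣ pairing n (seqC z y x n) P₁ := by
      rw [h, map_add, pairing_quad_mul (seqC_rec n) hw', zero_add, pairing_C_mul] at hC
      obtain ⟨e, he⟩ := hC
      refine ⟨e, ?_⟩
      rw [← sub_eq_zero]
      apply H.z_regular
      linear_combination he
    obtain ⟨w', P', hw', hP', h'⟩ := ih (by omega) P₁ (by rwa [h2]) hC₁
    refine ⟨w + C z * w', P', ?_, hP', ?_⟩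
    · refine (degree_add_le _ _).trans_lt (max_lt ‹_› ?_)
      rw [← smul_eq_C_mul]
      exact (degree_smul_le _ _).trans_lt hw'
    · rw [h, h', pow_succ, C_mul]; ring

end BaseSequences

/-! ### Regular minors and ranks -/

section Minors

variable {R : Type*} [CommRing R]

/-- The matrix `A` has a minor of size `r` that is a nonzerodivisor. Rows and columns are chosen by
arbitrary maps: a repetition would make the determinant vanish. -/
def HasRegularMinor {m n : Type*} (A : Matrix m n R) (r : ℕ) : Prop :=
  ∃ (a : Fin r → m) (b : Fin r → n), (A.submatrix a b).det ∈ R⁰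

theorem HasRegularMinor.of_card {m n κ : Type*} [Fintype κ] [DecidableEq κ] {A : Matrix m n R}
    {a : κ → m} {b : κ → n} (h : (A.submatrix a b).det ∈ R⁰) {r : ℕ} (hr : Fintype.card κ = r) :
    HasRegularMinor A r := by
  let e := (Fintype.equivFinOfCardEq hr).symm
  refine ⟨a ∘ e, b ∘ e, ?_⟩
  rwa [← submatrix_submatrix, det_submatrix_equiv_self]

theorem HasRegularMinor.of_submatrix {m n m' n' : Type*} {A : Matrix m n R} {a : m' → m}
    {b : n' → n} {r : ℕ} (h : HasRegularMinor (A.submatrix a b) r) : HasRegularMinor A r := by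
  obtain ⟨a', b', h⟩ := h
  exact ⟨a ∘ a', b ∘ b', by rwa [← submatrix_submatrix]⟩

theorem HasRegularMinor.submatrix_equiv {m n m' n' : Type*} {A : Matrix m n R} {r : ℕ}
    (h : HasRegularMinor A r) (e : m' ≃ m) (f : n' ≃ n) :
    HasRegularMinor (A.submatrix e f) r :=
  .of_submatrix (a := e.symm) (b := f.symm) (by simpa using h)

theorem HasRegularMinor.fromBlocks_unit {m n : Type*} {A : Matrix m n R} {r : ℕ}
    (h : HasRegularMinor A r) (B : Matrix m Unit R) {g : R} (hg : g ∈ R⁰) :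
    HasRegularMinor (fromBlocks A B 0 (of fun _ _ : Unit => g)) (r + 1) := by
  obtain ⟨a, b, h⟩ := h
  refine .of_card (κ := Fin r ⊕ Unit) (a := Sum.map a id) (b := Sum.map b id) ?_ (by simp)
  have : (fromBlocks A B 0 (of fun _ _ : Unit => g)).submatrix (Sum.map a id) (Sum.map b id) =
      fromBlocks (A.submatrix a b) (B.submatrix a id) 0 (of fun _ _ : Unit => g) := by
    ext (i | i) (j | j) <;> rfl
  rw [this, det_fromBlocks_zero₂₁]
  exact mul_mem h (by simpa [det_unique] using hg)

theorem injective_left_of_det_submatrix_ne_zero {m n κ : Type*} [Fintype κ] [DecidableEq κ]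
    {A : Matrix m n R} {a : κ → m} {b : κ → n} (h : (A.submatrix a b).det ≠ 0) :
    Function.Injective a := by
  intro i j hij
  by_contra hne
  exact h (det_zero_of_row_eq hne (by ext k; simp [hij]))

theorem injective_right_of_det_submatrix_ne_zero {m n κ : Type*} [Fintype κ] [DecidableEq κ]
    {A : Matrix m n R} {a : κ → m} {b : κ → n} (h : (A.submatrix a b).det ≠ 0) :
    Function.Injective b := by
  refine injective_left_of_det_submatrix_ne_zero (A := Aᵀ) (a := b) (b := a) ?_
  rwa [← transpose_submatrix, det_transpose]

theorem hasMinorRank_of_hasRegularMinor [Nontrivial R] {m n : ℕ} {A : Matrix (Fin m) (Fin n) R}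
    {r : ℕ} (h : HasRegularMinor A r) (hr : ∀ (k : ℕ) (a : Fin k ↪ Fin m) (b : Fin k ↪ Fin n),
      (A.submatrix a b).det ≠ 0 → k ≤ r) : HasMinorRank A r := by
  obtain ⟨a, b, hab⟩ := h
  have h0 := nonZeroDivisors.ne_zero hab
  refine ⟨⟨⟨a, injective_left_of_det_submatrix_ne_zero h0⟩,
    ⟨b, injective_right_of_det_submatrix_ne_zero h0⟩, h0⟩, ?_⟩
  rintro k ⟨a, b, hab⟩
  exact hr k a b hab

theorem det_mul_eq_zero_of_card_lt {m n : Type*} [Fintype m] [DecidableEq m] [Fintype n]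
    (A : Matrix m n R) (B : Matrix n m R) (h : Fintype.card n < Fintype.card m) :
    (A * B).det = 0 := by
  -- pad `A` with zero columns and `B` with zero rows to square matrices
  let p := Fin (Fintype.card m - Fintype.card n)
  let e : m ≃ n ⊕ p := Fintype.equivOfCardEq (by simp [p]; omega)
  let q : p := ⟨0, by omega⟩
  have : A * B = (fromCols A (0 : Matrix m p R)).submatrix id e *
      (fromRows B (0 : Matrix p m R)).submatrix e id := by
    rw [submatrix_mul_equiv, fromCols_mul_fromRows]; simp
  rw [this, det_mul, det_eq_zero_of_column_eq_zero (e.symm (Sum.inr q)) (by simp), zero_mul]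

theorem exists_mul_eq_smul_one {ι₀ ι₁ : Type*} [Fintype ι₀] [DecidableEq ι₀] [Fintype ι₁]
    [DecidableEq ι₁] [Nontrivial R] {d₁ : Matrix ι₀ ι₁ R}
    (h : HasRegularMinor d₁ (Fintype.card ι₀)) :
    ∃ s : Matrix ι₁ ι₀ R, ∃ δ ∈ R⁰, d₁ * s = δ • (1 : Matrix ι₀ ι₀ R) := by
  obtain ⟨a, b, hab⟩ := h
  have ha : Function.Bijective a := (Fintype.bijective_iff_injective_and_card _).2
    ⟨injective_left_of_det_submatrix_ne_zero (nonZeroDivisors.ne_zero hab), by simp⟩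
  let e := Equiv.ofBijective a ha
  let M := d₁.submatrix a b
  refine ⟨(1 : Matrix ι₁ ι₁ R).submatrix id b * M.adjugate.submatrix id e.symm, _, hab, ?_⟩
  have h1 : d₁ * (1 : Matrix ι₁ ι₁ R).submatrix id b = M.submatrix e.symm id := by
    have : d₁ = d₁.submatrix id id := rfl
    conv_lhs => rw [this]
    rw [← submatrix_mul _ _ _ _ _ Function.bijective_id, Matrix.mul_one]
    ext i j
    simp only [submatrix_apply, id, M]
    rw [show a (e.symm i) = i from e.apply_symm_apply i]
  rw [← Matrix.mul_assoc, h1, ← submatrix_mul _ _ _ _ _ Function.bijective_id, mul_adjugate]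
  ext i j
  simp [Matrix.one_apply, M]

/-- If `d₁` becomes split surjective after inverting a nonzerodivisor and `d₁ * d₂ = 0`, then the
rank of `d₂` is at most the rank of the kernel of `d₁`: a nonvanishing minor of `d₂` can be
enlarged by the rank of `d₁`, to a minor of a product that factors through `F₁`. -/
theorem card_le_of_det_submatrix_ne_zero {ι₀ ι₁ ι₂ κ : Type*} [Fintype ι₀] [DecidableEq ι₀]
    [Fintype ι₁] [DecidableEq ι₁] [Fintype κ] [DecidableEq κ] [Nontrivial R]
    {d₁ : Matrix ι₀ ι₁ R} {d₂ : Matrix ι₁ ι₂ R} (hd : d₁ * d₂ = 0)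
    (h : HasRegularMinor d₁ (Fintype.card ι₀)) {r : ℕ}
    (hr : Fintype.card ι₁ = Fintype.card ι₀ + r) {a : κ → ι₁} {b : κ → ι₂}
    (hab : (d₂.submatrix a b).det ≠ 0) : Fintype.card κ ≤ r := by
  by_contra! hlt
  obtain ⟨s, δ, hδ, hs⟩ := exists_mul_eq_smul_one h
  apply hab
  have hblock : fromRows ((1 : Matrix ι₁ ι₁ R).submatrix a id) d₁ *
      fromCols (d₂.submatrix id b) s =
      fromBlocks (d₂.submatrix a b) (s.submatrix a id) 0 (δ • (1 : Matrix ι₀ ι₀ R)) := by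
    have h1 : d₁ * d₂.submatrix id b = 0 := by
      ext i j
      exact congrFun (congrFun hd i) (b j)
    have h2 : ∀ {l : Type _} (N : Matrix ι₁ l R),
        (1 : Matrix ι₁ ι₁ R).submatrix a id * N = N.submatrix a id := by
      intro l N
      ext i j
      simp [Matrix.mul_apply, Matrix.one_apply]
    have h3 : (1 : Matrix ι₁ ι₁ R).submatrix a id * d₂.submatrix id b = d₂.submatrix a b := by
      ext i j
      simp [Matrix.mul_apply, Matrix.one_apply]
    rw [fromRows_mul_fromCols, h1, hs, h2 s, h3]
  have hdet := congrArg det hblock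
  rw [det_mul_eq_zero_of_card_lt _ _ (by rw [Fintype.card_sum, hr]; omega),
    det_fromBlocks_zero₂₁, det_smul, det_one, mul_one] at hdet
  exact (mem_nonZeroDivisors_iff_right.1 (pow_mem hδ _)) _ hdet.symm

end Minors

theorem submatrix_exact {R l m n l' m' n' : Type*} [CommRing R] [Fintype m] [Fintype n]
    [Fintype m'] [Fintype n'] {A : Matrix l m R} {B : Matrix m n R} (e : l' ≃ l) (f : m' ≃ m)
    (g : n' ≃ n) (hAB : ∀ u, A *ᵥ u = 0 → ∃ v, B *ᵥ v = u) (u : m' → R)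
    (hu : A.submatrix e f *ᵥ u = 0) : ∃ v, B.submatrix f g *ᵥ v = u := by
  rw [submatrix_mulVec_equiv] at hu
  obtain ⟨v, hv⟩ := hAB (u ∘ f.symm) (by
    ext i
    simpa using congrFun hu (e.symm i))
  refine ⟨v ∘ g, ?_⟩
  rw [submatrix_mulVec_equiv]
  ext i
  simpa [Function.comp_assoc] using congrFun hv (f i)

/-! ### Minimal resolutions of length three -/

section Resolutions

variable {R : Type*} [CommRing R] [IsLocalRing R]

/-- The matrices `d₁, d₂, d₃`, with rows and columns indexed by arbitrary finite types, are the
differentials of a minimal acyclic complex, and they have regular minors of the sizes `r₁, r₂, r₃`.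
-/
structure IsMinimalResolution {ι₀ ι₁ ι₂ ι₃ : Type*} [Fintype ι₁] [Fintype ι₂]
    [Fintype ι₃] (d₁ : Matrix ι₀ ι₁ R) (d₂ : Matrix ι₁ ι₂ R) (d₃ : Matrix ι₂ ι₃ R)
    (r₁ r₂ r₃ : ℕ) : Prop where
  d₁_mul_d₂ : d₁ * d₂ = 0
  d₂_mul_d₃ : d₂ * d₃ = 0
  exact₁ : ∀ u, d₁ *ᵥ u = 0 → ∃ v, d₂ *ᵥ v = u
  exact₂ : ∀ v, d₂ *ᵥ v = 0 → ∃ w, d₃ *ᵥ w = v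
  exact₃ : ∀ w, d₃ *ᵥ w = 0 → w = 0
  min₁ : ∀ i j, d₁ i j ∈ maximalIdeal R
  min₂ : ∀ i j, d₂ i j ∈ maximalIdeal R
  min₃ : ∀ i j, d₃ i j ∈ maximalIdeal R
  minor₁ : HasRegularMinor d₁ r₁
  minor₂ : HasRegularMinor d₂ r₂
  minor₃ : HasRegularMinor d₃ r₃

namespace IsMinimalResolution

variable {ι₀ ι₁ ι₂ ι₃ : Type*} [Fintype ι₁] [Fintype ι₂] [Fintype ι₃]
  {d₁ : Matrix ι₀ ι₁ R} {d₂ : Matrix ι₁ ι₂ R} {d₃ : Matrix ι₂ ι₃ R} {r₁ r₂ r₃ : ℕ}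

theorem reindex {κ₀ κ₁ κ₂ κ₃ : Type*} [Fintype κ₁] [Fintype κ₂] [Fintype κ₃]
    (h : IsMinimalResolution d₁ d₂ d₃ r₁ r₂ r₃) (e₀ : κ₀ ≃ ι₀) (e₁ : κ₁ ≃ ι₁) (e₂ : κ₂ ≃ ι₂)
    (e₃ : κ₃ ≃ ι₃) :
    IsMinimalResolution (d₁.submatrix e₀ e₁) (d₂.submatrix e₁ e₂) (d₃.submatrix e₂ e₃)
      r₁ r₂ r₃ := by
  refine ⟨?_, ?_, submatrix_exact _ _ _ h.exact₁,
    submatrix_exact _ _ _ h.exact₂, ?_, fun _ _ => h.min₁ _ _,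
    fun _ _ => h.min₂ _ _, fun _ _ => h.min₃ _ _, h.minor₁.submatrix_equiv _ _,
    h.minor₂.submatrix_equiv _ _, h.minor₃.submatrix_equiv _ _⟩
  · rw [submatrix_mul_equiv, h.d₁_mul_d₂]; rfl
  · rw [submatrix_mul_equiv, h.d₂_mul_d₃]; rfl
  · intro w hw
    rw [submatrix_mulVec_equiv] at hw
    have := h.exact₃ (w ∘ e₃.symm) (by
      ext i
      simpa using congrFun hw (e₂.symm i))
    ext i
    simpa using congrFun this (e₃ i)

/-- The direct sum with the complex `0 → 0 → R → R` given by a nonzerodivisor. -/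
theorem directSum (h : IsMinimalResolution d₁ d₂ d₃ r₁ r₂ r₃) {z : R} (hz : z ∈ R⁰)
    (hzm : z ∈ maximalIdeal R) :
    IsMinimalResolution (fromBlocks d₁ 0 0 (of fun _ _ : Unit => z))
      (fromRows d₂ (0 : Matrix Unit ι₂ R)) d₃ (r₁ + 1) r₂ r₃ where
  d₁_mul_d₂ := by
    rw [← fromRows_fromCols_eq_fromBlocks, fromRows_mul, fromCols_mul_fromRows,
      fromCols_mul_fromRows, h.d₁_mul_d₂]
    simp
  d₂_mul_d₃ := by rw [fromRows_mul, h.d₂_mul_d₃]; simp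
  exact₁ u hu := by
    obtain ⟨u, v, rfl⟩ : ∃ (u₁ : ι₁ → R) (v : R), u = Sum.elim u₁ (fun _ => v) :=
      ⟨u ∘ Sum.inl, u (Sum.inr ()), by ext (i | i) <;> rfl⟩
    rw [fromBlocks_mulVec] at hu
    have h₁ : d₁ *ᵥ u = 0 := by
      ext i
      simpa using congrFun hu (Sum.inl i)
    have h₂ : z * v = 0 := by
      simpa [mulVec, dotProduct] using congrFun hu (Sum.inr ())
    obtain ⟨t, ht⟩ := h.exact₁ u h₁
    refine ⟨t, ?_⟩
    rw [fromRows_mulVec, ht, mul_left_mem_nonZeroDivisors_eq_zero_iff hz |>.1 h₂]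
    ext (i | i) <;> simp
  exact₂ v hv := h.exact₂ v (by
    rw [fromRows_mulVec] at hv
    ext i
    simpa using congrFun hv (Sum.inl i))
  exact₃ := h.exact₃
  min₁ := by
    rintro (i | i) (j | j)
    · exact h.min₁ i j
    · exact zero_mem _
    · exact zero_mem _
    · exact hzm
  min₂ := by
    rintro (i | i) j
    · exact h.min₂ i j
    · exact zero_mem _
  min₃ := h.min₃
  minor₁ := h.minor₁.fromBlocks_unit 0 hz
  minor₂ := .of_submatrix (a := Sum.inl) (b := id) h.minor₂
  minor₃ := h.minor₃

/-- If `d₁` presents the cyclic module `R/I`, and `h ∈ I` is the image of `w`, then this complex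
resolves `R/(gI + (h))`. It is the mapping cone that comes from `gI ∩ (h) = (gh)`. -/
theorem cone {d₁ : Matrix Unit ι₁ R} (H : IsMinimalResolution d₁ d₂ d₃ 1 r₂ r₃) {g h : R}
    (hg : g ∈ R⁰) (hh : h ∈ R⁰) (hgm : g ∈ maximalIdeal R) (hhm : h ∈ maximalIdeal R)
    (hgh : ∀ a, g ∣ h * a → g ∣ a) {w : ι₁ → R} (hw : d₁ *ᵥ w = fun _ => h)
    (hwm : ∀ i, w i ∈ maximalIdeal R) :
    IsMinimalResolution (fromCols (g • d₁) (of fun _ _ : Unit => h))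
      (fromBlocks d₂ (-replicateCol Unit w) 0 (of fun _ _ : Unit => g))
      (fromRows d₃ (0 : Matrix Unit ι₃ R)) 1 (r₂ + 1) r₃ where
  d₁_mul_d₂ := by
    have hw' : d₁ * replicateCol Unit w = of fun _ _ => h := by
      ext i j
      exact congrFun hw i
    rw [fromCols_mul_fromBlocks, Matrix.smul_mul, H.d₁_mul_d₂, Matrix.mul_neg, Matrix.smul_mul,
      hw']
    ext i (j | j)
    · simp
    · simp [Matrix.mul_apply, mul_comm]
  d₂_mul_d₃ := by
    rw [fromBlocks_mul_fromRows, H.d₂_mul_d₃]; simp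
  exact₁ u hu := by
    obtain ⟨u, v, rfl⟩ : ∃ (u₁ : ι₁ → R) (v : R), u = Sum.elim u₁ (fun _ => v) :=
      ⟨u ∘ Sum.inl, u (Sum.inr ()), by ext (i | i) <;> rfl⟩
    rw [fromCols_mulVec] at hu
    have hu : g * (d₁ *ᵥ u) () + h * v = 0 := by
      simpa [mulVec, dotProduct, Finset.mul_sum, mul_assoc] using congrFun hu ()
    obtain ⟨v, rfl⟩ := hgh v ⟨-(d₁ *ᵥ u) (), by linear_combination hu⟩
    have h0 : (d₁ *ᵥ u) () + h * v = 0 := by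
      apply (mul_left_mem_nonZeroDivisors_eq_zero_iff hg).1
      linear_combination hu
    obtain ⟨t, ht⟩ := H.exact₁ (u + v • w) (by
      ext
      rw [mulVec_add, mulVec_smul, hw]
      simpa [mul_comm] using h0)
    refine ⟨Sum.elim t (fun _ => v), ?_⟩
    rw [fromBlocks_mulVec]
    ext (i | i)
    · simp [ht, mulVec, dotProduct, mul_comm]
    · simp [mulVec, dotProduct]
  exact₂ u hu := by
    obtain ⟨u, v, rfl⟩ : ∃ (u₁ : ι₂ → R) (v : R), u = Sum.elim u₁ (fun _ => v) :=
      ⟨u ∘ Sum.inl, u (Sum.inr ()), by ext (i | i) <;> rfl⟩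
    rw [fromBlocks_mulVec] at hu
    have hv : g * v = 0 := by
      simpa [mulVec, dotProduct] using congrFun hu (Sum.inr ())
    obtain rfl := (mul_left_mem_nonZeroDivisors_eq_zero_iff hg).1 hv
    obtain ⟨t, ht⟩ := H.exact₂ u (by
      ext i
      simpa [mulVec, dotProduct] using congrFun hu (Sum.inl i))
    refine ⟨t, ?_⟩
    rw [fromRows_mulVec, ht]
    ext (i | i) <;> simp
  exact₃ v hv := H.exact₃ v (by
    rw [fromRows_mulVec] at hv
    ext i
    simpa using congrFun hv (Sum.inl i))
  min₁ := by
    rintro i (j | j)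
    · exact Ideal.mul_mem_right _ _ hgm
    · exact hhm
  min₂ := by
    rintro (i | i) (j | j)
    · exact H.min₂ i j
    · exact neg_mem (hwm i)
    · exact zero_mem _
    · exact hgm
  min₃ := by
    rintro (i | i) j
    · exact H.min₃ i j
    · exact zero_mem _
  minor₁ := .of_card (κ := Unit) (a := id) (b := Sum.inr) (by simpa [det_unique] using hh) (by simp)
  minor₂ := H.minor₂.fromBlocks_unit _ hg
  minor₃ := .of_submatrix (a := Sum.inl) (b := id) H.minor₃

end IsMinimalResolution

end Resolutions

/-! ### The base complex as a minimal resolution -/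

section BaseComplex

variable {R : Type*} [CommRing R]

/-- The polynomial of degree less than `m` with given coefficients. -/
noncomputable def polyOfFn {m : ℕ} (v : Fin m → R) : R[X] := ∑ j, C (v j) * X ^ (j : ℕ)

theorem coeff_polyOfFn {m : ℕ} (v : Fin m → R) (i : Fin m) : (polyOfFn v).coeff i = v i := by
  simp [polyOfFn, coeff_X_pow, Fin.val_inj]

theorem degree_polyOfFn_lt {m : ℕ} (v : Fin m → R) : (polyOfFn v).degree < m := by
  rw [degree_lt_iff_coeff_zero]
  intro i hi
  rw [polyOfFn, finsetSum_coeff]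
  refine Finset.sum_eq_zero fun j _ => ?_
  rw [coeff_C_mul_X_pow, if_neg (by omega)]

theorem polyOfFn_coeff {m : ℕ} {P : R[X]} (hP : P.degree < m) :
    polyOfFn (fun i : Fin m => P.coeff i) = P := by
  rw [polyOfFn, Fin.sum_univ_eq_sum_range (fun i => C (P.coeff i) * X ^ i)]
  exact (eq_sum_of_degree_lt hP).symm

theorem pairing_polyOfFn {n : ℕ} (s : ℕ → R) (v : Fin (n + 2) → R) :
    pairing n s (polyOfFn v) = ∑ i : Fin (n + 2), s i * v i := by
  rw [pairing_apply, ← Fin.sum_univ_eq_sum_range (fun i => s i * (polyOfFn v).coeff i)]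
  simp only [coeff_polyOfFn]

theorem pairing_linear (n : ℕ) (s : ℕ → R) (a b : R) :
    pairing n s (C a + C b * X) = a * s 0 + b * s 1 := by
  have h0 := pairing_X_pow (n := n) s (i := 0) (by omega)
  have h1 := pairing_X_pow (n := n) s (i := 1) (by omega)
  rw [pow_zero] at h0
  rw [pow_one] at h1
  rw [← mul_one (C a), map_add, pairing_C_mul, pairing_C_mul, h0, h1]

variable (z y x : R) (n : ℕ)

/-- The differential `F₁ → F₀` of the base complex. -/
def baseD₁ : Matrix Unit (Fin 3) R :=
  of fun _ => ![recSeq z y x (n + 1), x * recSeq z y x n, -z ^ n]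

/-- The differential `F₂ → F₁` of the base complex. Its rows are the functionals on polynomials of
degree at most `n + 1` given by `seqA`, `seqB` and `seqC`, which vanish on the multiples of
`quad`. -/
def baseD₂ : Matrix (Fin 3) (Fin (n + 2)) R :=
  of fun k i => ![seqA z y x n i, seqB z y x n i, seqC z y x n i] k

/-- The differential `F₃ → F₂` of the base complex: multiplication by `quad`, from polynomials of
degree less than `n` to polynomials of degree less than `n + 2`. -/
noncomputable def baseD₃ : Matrix (Fin (n + 2)) (Fin n) R :=
  of fun i j => (quad z y x * X ^ (j : ℕ)).coeff i

variable {z y x n}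

theorem baseD₃_mulVec (w : Fin n → R) (i : Fin (n + 2)) :
    (baseD₃ z y x n *ᵥ w) i = (quad z y x * polyOfFn w).coeff i := by
  rw [polyOfFn, Finset.mul_sum, finsetSum_coeff]
  simp only [mulVec, dotProduct, baseD₃, of_apply]
  refine Finset.sum_congr rfl fun j _ => ?_
  rw [mul_left_comm, coeff_C_mul, mul_comm]

theorem baseD₂_mulVec (v : Fin (n + 2) → R) : baseD₂ z y x n *ᵥ v =
    ![pairing n (seqA z y x n) (polyOfFn v), pairing n (seqB z y x n) (polyOfFn v),
      pairing n (seqC z y x n) (polyOfFn v)] := by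
  ext k
  fin_cases k <;> simp [mulVec, dotProduct, baseD₂, pairing_polyOfFn]

theorem baseD₁_mulVec (u : Fin 3 → R) (i : Unit) : (baseD₁ z y x n *ᵥ u) i =
    recSeq z y x (n + 1) * u 0 + x * recSeq z y x n * u 1 - z ^ n * u 2 := by
  simp [mulVec, dotProduct, baseD₁, Fin.sum_univ_three, sub_eq_add_neg]

theorem degree_quad_mul_lt {w : R[X]} (hw : w.degree < n) :
    (quad z y x * w).degree < (n + 2 : ℕ) := by
  rw [degree_lt_iff_coeff_zero] at hw ⊢
  intro m hm
  obtain ⟨k, rfl⟩ : ∃ k, m = k + 2 := ⟨m - 2, by omega⟩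
  have : quad z y x * w = C x * w + C y * (w * X) + C z * (w * X ^ 2) := by rw [quad]; ring
  rw [this]
  simp only [coeff_add, coeff_C_mul, coeff_mul_X, coeff_mul_X_pow]
  rw [hw _ (by omega), hw _ (by omega), hw _ (by omega)]; simp

theorem baseD₃_injective (H : IsRegularTriple z y x) (w : Fin n → R)
    (hw : baseD₃ z y x n *ᵥ w = 0) : w = 0 := by
  have h0 : quad z y x * polyOfFn w = 0 := by
    rw [← polyOfFn_coeff (degree_quad_mul_lt (z := z) (y := y) (x := x) (degree_polyOfFn_lt w))]
    have : (fun i : Fin (n + 2) => (quad z y x * polyOfFn w).coeff i) = 0 := by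
      ext i
      rw [← baseD₃_mulVec, hw]
    rw [this]
    simp [polyOfFn]
  have h1 : polyOfFn w = 0 := by
    by_contra hne
    -- the leading coefficient of `quad` is the regular element `z`
    apply hne
    rw [← leadingCoeff_eq_zero]
    apply H.z_regular
    have hc := congrArg (fun P => coeff P ((polyOfFn w).natDegree + 2)) h0
    have : quad z y x * polyOfFn w =
        C x * polyOfFn w + C y * (polyOfFn w * X) + C z * (polyOfFn w * X ^ 2) := by
      rw [quad]; ring
    simp only [this, coeff_add, coeff_C_mul, coeff_mul_X_pow, coeff_mul_X, coeff_zero] at hc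
    rwa [coeff_eq_zero_of_natDegree_lt (by omega), coeff_eq_zero_of_natDegree_lt (by omega),
      mul_zero, mul_zero, zero_add, zero_add] at hc
  ext i
  rw [← coeff_polyOfFn w, h1]; simp

theorem IsRegularTriple.z_mem_nonZeroDivisors (H : IsRegularTriple z y x) : z ∈ R⁰ :=
  mem_nonZeroDivisors_iff_left.2 H.z_regular

theorem IsRegularTriple.y_mem_nonZeroDivisors (H : IsRegularTriple z y x) : y ∈ R⁰ :=
  mem_nonZeroDivisors_iff_left.2 H.y_regular

theorem IsRegularTriple.dvd_of_dvd_z_pow_mul (H : IsRegularTriple z y x) (k : ℕ) :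
    ∀ a, y ∣ z ^ k * a → y ∣ a := by
  induction k with
  | zero => simp
  | succ k ih => exact fun a h => ih a (H.z_regular_mod_y _ (by convert h using 1; ring))

theorem hasRegularMinor_baseD₂ (H : IsRegularTriple z y x) :
    HasRegularMinor (baseD₂ z y x n) 2 := by
  refine ⟨![0, 1], ![0, 1], ?_⟩
  rw [det_fin_two]
  simp only [baseD₂, submatrix_apply, of_apply, Matrix.cons_val_zero, Matrix.cons_val_one]
  have h0 : ((0 : Fin (n + 2)) : ℕ) = 0 := rfl
  have h1 : ((1 : Fin (n + 2)) : ℕ) = 1 := rfl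
  have : seqA z y x n ((0 : Fin (n + 2)) : ℕ) * seqB z y x n ((1 : Fin (n + 2)) : ℕ) -
      seqA z y x n ((1 : Fin (n + 2)) : ℕ) * seqB z y x n ((0 : Fin (n + 2)) : ℕ) =
      z ^ n * z ^ n := by
    rw [h0, h1]; simp [seqA, seqB, recSeq]
  rw [this]
  exact mul_mem (pow_mem H.z_mem_nonZeroDivisors n) (pow_mem H.z_mem_nonZeroDivisors n)

theorem coeff_quad_mul_X_pow (i j : ℕ) : (quad z y x * X ^ j).coeff i =
    (if i = j then x else 0) + (if i = j + 1 then y else 0) + if i = j + 2 then z else 0 := by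
  have : quad z y x * X ^ j = C x * X ^ j + C y * X ^ (j + 1) + C z * X ^ (j + 2) := by
    rw [quad]; ring
  rw [this]
  simp only [coeff_add, coeff_C_mul_X_pow]

theorem hasRegularMinor_baseD₃ (H : IsRegularTriple z y x) :
    HasRegularMinor (baseD₃ z y x n) n := by
  -- the last `n` rows form an upper triangular matrix with diagonal entries `z`
  refine ⟨fun i => ⟨i + 2, by omega⟩, id, ?_⟩
  rw [det_of_isUpperTriangular]
  · refine prod_mem fun i _ => ?_
    have : ((baseD₃ z y x n).submatrix (fun i : Fin n => (⟨i + 2, by omega⟩ : Fin (n + 2))) id) i i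
        = z := by
      simp [baseD₃, coeff_quad_mul_X_pow]
    rw [this]
    exact H.z_mem_nonZeroDivisors
  · intro i j hij
    have hij : (j : ℕ) < i := hij
    simp only [baseD₃, submatrix_apply, of_apply, id, coeff_quad_mul_X_pow]
    rw [if_neg (by omega), if_neg (by omega), if_neg (by omega)]
    simp

theorem recSeq_mem [IsLocalRing R] (hz : z ∈ maximalIdeal R) (hy : y ∈ maximalIdeal R)
    (hn : n ≠ 0) : recSeq z y x (n + 1) ∈ maximalIdeal R := by
  obtain ⟨k, rfl⟩ := Nat.exists_eq_succ_of_ne_zero hn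
  rw [recSeq]
  exact sub_mem (Ideal.mul_mem_right _ _ (neg_mem hy))
    (Ideal.mul_mem_right _ _ (Ideal.mul_mem_left _ _ hz))

/-- The base complex resolves a cyclic module with three relations whose last Betti number is `n`:
the ideal generated by `recSeq (n + 1)`, `x * recSeq n` and `z ^ n`. -/
theorem isMinimalResolution_base [IsLocalRing R] (H : IsRegularTriple z y x)
    (hz : z ∈ maximalIdeal R) (hy : y ∈ maximalIdeal R) (hx : x ∈ maximalIdeal R) (hn : n ≠ 0) :
    IsMinimalResolution (baseD₁ z y x n) (baseD₂ z y x n) (baseD₃ z y x n) 1 2 n where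
  d₁_mul_d₂ := by
    ext i j
    have := pow_mul_seqC (y := y) (x := x) H.z_regular n j j.2
    simp only [Matrix.mul_apply, baseD₁, baseD₂, of_apply, Fin.sum_univ_three,
      Matrix.cons_val, Matrix.zero_apply]
    linear_combination -this
  d₂_mul_d₃ := by
    have key : ∀ w, baseD₂ z y x n *ᵥ (baseD₃ z y x n *ᵥ w) = 0 := by
      intro w
      have hw : polyOfFn (baseD₃ z y x n *ᵥ w) = quad z y x * polyOfFn w := by
        rw [← polyOfFn_coeff (degree_quad_mul_lt (degree_polyOfFn_lt w))]
        congr 1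
        ext i
        exact baseD₃_mulVec w i
      rw [baseD₂_mulVec, hw, pairing_quad_mul (seqA_rec n) (degree_polyOfFn_lt w),
        pairing_quad_mul (seqB_rec n) (degree_polyOfFn_lt w),
        pairing_quad_mul (seqC_rec n) (degree_polyOfFn_lt w)]
      ext k
      fin_cases k <;> rfl
    apply Matrix.ext_of_mulVec_single
    intro j
    rw [← mulVec_mulVec, key, zero_mulVec]
  exact₁ u hu := by
    have h := congrFun hu ()
    rw [baseD₁_mulVec] at h
    have hA : pairing n (seqA z y x n) (C (u 0) + C (u 1) * X) = z ^ n * u 0 := by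
      rw [pairing_linear]; simp [seqA, recSeq, mul_comm]
    have hB : pairing n (seqB z y x n) (C (u 0) + C (u 1) * X) = z ^ n * u 1 := by
      rw [pairing_linear]; simp [seqB, recSeq, mul_comm]
    have hC : pairing n (seqC z y x n) (C (u 0) + C (u 1) * X) = z ^ n * u 2 := by
      rw [pairing_linear]
      simp only [seqC, pow_zero, pow_one, Nat.sub_zero, Nat.add_sub_cancel, one_mul]
      rw [Pi.zero_apply] at h
      linear_combination h
    have hdeg : (C (u 0) + C (u 1) * X).degree < ((n + 2 - n : ℕ) : WithBot ℕ) := by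
      rw [Nat.add_sub_cancel_left, add_comm]
      exact degree_linear_le.trans_lt (by norm_num)
    obtain ⟨w, P, hw, hP, hPw⟩ := exists_eq_quad_mul_add_of_pow_dvd H le_rfl
      (C (u 0) + C (u 1) * X) hdeg (hC ▸ dvd_mul_right _ _)
    have hcancel : ∀ a b, z ^ n * a = z ^ n * b → a = b := fun a b hab => by
      rw [← sub_eq_zero]
      apply (mul_left_mem_nonZeroDivisors_eq_zero_iff (pow_mem H.z_mem_nonZeroDivisors n)).1
      rw [mul_sub, hab, sub_self]
    rw [hPw, map_add, pairing_C_mul, pairing_quad_mul (seqA_rec n) hw, zero_add] at hA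
    rw [hPw, map_add, pairing_C_mul, pairing_quad_mul (seqB_rec n) hw, zero_add] at hB
    rw [hPw, map_add, pairing_C_mul, pairing_quad_mul (seqC_rec n) hw, zero_add] at hC
    refine ⟨fun i => P.coeff i, ?_⟩
    rw [baseD₂_mulVec, polyOfFn_coeff hP, hcancel _ _ hA, hcancel _ _ hB, hcancel _ _ hC]
    ext k
    fin_cases k <;> rfl
  exact₂ v hv := by
    rw [baseD₂_mulVec] at hv
    obtain ⟨w, hw, hvw⟩ := exists_eq_quad_mul H n (polyOfFn v) (degree_polyOfFn_lt v)
      (congrFun hv 0) (congrFun hv 1)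
    refine ⟨fun i => w.coeff i, ?_⟩
    ext i
    rw [baseD₃_mulVec, polyOfFn_coeff hw, ← hvw, coeff_polyOfFn]
  exact₃ := baseD₃_injective H
  min₁ i j := by
    have h1 := recSeq_mem (x := x) hz hy hn
    have h2 : x * recSeq z y x n ∈ maximalIdeal R := Ideal.mul_mem_right _ _ hx
    have h3 : -z ^ n ∈ maximalIdeal R := neg_mem (Ideal.pow_mem_of_mem _ hz _ (by omega))
    fin_cases j
    exacts [h1, h2, h3]
  min₂ k i := by
    obtain ⟨i, hi⟩ := i
    have h1 : seqA z y x n i ∈ maximalIdeal R := by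
      rcases i with _ | i
      · exact Ideal.pow_mem_of_mem _ hz _ (by omega)
      · exact neg_mem (Ideal.mul_mem_right _ _ (Ideal.mul_mem_right _ _ hx))
    have h2 : seqB z y x n i ∈ maximalIdeal R := by
      rcases (by omega : i < n + 1 ∨ i = n + 1) with h | rfl
      · exact Ideal.mul_mem_right _ _ (Ideal.pow_mem_of_mem _ hz _ (by omega))
      · exact Ideal.mul_mem_left _ _ (recSeq_mem hz hy hn)
    have h3 : seqC z y x n i ∈ maximalIdeal R := by
      rcases i with _ | i
      · exact Ideal.mul_mem_left _ _ (recSeq_mem hz hy hn)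
      · exact Ideal.mul_mem_right _ _ (Ideal.pow_mem_of_mem _ hx _ (by omega))
    fin_cases k
    exacts [h1, h2, h3]
  min₃ i j := by
    simp only [baseD₃, of_apply, coeff_quad_mul_X_pow]
    refine add_mem (add_mem ?_ ?_) ?_ <;> split_ifs <;> first | assumption | exact zero_mem _
  minor₁ := by
    refine .of_card (κ := Unit) (a := id) (b := fun _ => 2) ?_ (by simp)
    rw [det_unique]
    change -z ^ n ∈ R⁰
    rw [neg_eq_neg_one_mul]
    exact mul_mem isUnit_one.neg.mem_nonZeroDivisors (pow_mem H.z_mem_nonZeroDivisors n)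
  minor₂ := hasRegularMinor_baseD₂ H
  minor₃ := hasRegularMinor_baseD₃ H

end BaseComplex

/-! ### Existence for all formats -/

section Existence

variable {R : Type*} [CommRing R] [IsLocalRing R]

/-- There is a minimal resolution `0 → Rⁿ → R^{k + n} → R^{1 + k} → R` of a cyclic module `R/I`,
with regular minors of sizes `n`, `k`, `1`, such that `I` contains a power of `z`. -/
def HasCyclicResolution (z : R) (k n : ℕ) : Prop :=
  ∃ (ι₁ ι₂ ι₃ : Type) (_ : Fintype ι₁) (_ : Fintype ι₂) (_ : Fintype ι₃)
    (d₁ : Matrix Unit ι₁ R) (d₂ : Matrix ι₁ ι₂ R) (d₃ : Matrix ι₂ ι₃ R),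
    Fintype.card ι₁ = 1 + k ∧ Fintype.card ι₂ = k + n ∧ Fintype.card ι₃ = n ∧
      IsMinimalResolution d₁ d₂ d₃ 1 k n ∧ ∃ (N : ℕ) (w : ι₁ → R), d₁ *ᵥ w = fun _ => z ^ N

variable {z y x : R}

theorem hasCyclicResolution_base (H : IsRegularTriple z y x)
    (hz : z ∈ maximalIdeal R) (hy : y ∈ maximalIdeal R) (hx : x ∈ maximalIdeal R) {n : ℕ}
    (hn : n ≠ 0) : HasCyclicResolution z 2 n :=
  ⟨Fin 3, Fin (n + 2), Fin n, inferInstance, inferInstance, inferInstance, _, _, _, by simp,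
    by simp [add_comm], by simp, isMinimalResolution_base H hz hy hx hn, n, ![0, 0, -1], by
      ext i
      simp [baseD₁_mulVec]⟩

theorem hasCyclicResolution_zero (H : IsRegularTriple z y x) (hz : z ∈ maximalIdeal R) :
    HasCyclicResolution z 0 0 := by
  refine ⟨Unit, Empty, Empty, inferInstance, inferInstance, inferInstance, of fun _ _ => z, 0, 0,
    by simp, by simp, by simp, ?_, 1, 1, by ext; simp [mulVec, dotProduct]⟩
  refine ⟨by simp, by simp, ?_, fun v _ => ⟨0, Subsingleton.elim _ _⟩,
    fun w _ => Subsingleton.elim _ _, fun _ _ => hz, fun _ _ => zero_mem _, fun _ _ => zero_mem _,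
    ?_, ?_, ?_⟩
  · intro u hu
    refine ⟨0, ?_⟩
    ext i
    have : z * u () = 0 := by simpa [mulVec, dotProduct] using congrFun hu ()
    simp [H.z_regular _ this]
  · exact .of_card (κ := Unit) (a := id) (b := id)
      (by simpa [det_unique] using H.z_mem_nonZeroDivisors) (by simp)
  · exact ⟨Fin.elim0, Fin.elim0, by simp⟩
  · exact ⟨Fin.elim0, Fin.elim0, by simp⟩

theorem HasCyclicResolution.succ (H : IsRegularTriple z y x) (hz : z ∈ maximalIdeal R)
    (hy : y ∈ maximalIdeal R) {k n : ℕ} (h : HasCyclicResolution z k n) :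
    HasCyclicResolution z (k + 1) n := by
  obtain ⟨ι₁, ι₂, ι₃, _, _, _, d₁, d₂, d₃, c₁, c₂, c₃, h, N, w, hw⟩ := h
  -- the factor `z` in `z ^ (N + 1) = d₁ (z • w)` keeps the cone minimal
  have hw' : d₁ *ᵥ (z • w) = fun _ => z ^ (N + 1) := by
    rw [mulVec_smul, hw]
    ext
    simp [pow_succ']
  refine ⟨ι₁ ⊕ Unit, ι₂ ⊕ Unit, ι₃, inferInstance, inferInstance, inferInstance, _, _, _,
    by simp [c₁, add_assoc], by simp [c₂]; omega, c₃,
    h.cone H.y_mem_nonZeroDivisors (pow_mem H.z_mem_nonZeroDivisors (N + 1)) hy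
      (Ideal.pow_mem_of_mem _ hz _ (by omega)) (H.dvd_of_dvd_z_pow_mul _) hw'
      (fun i => Ideal.mul_mem_right _ _ hz), N + 1, Sum.elim 0 1, ?_⟩
  rw [fromCols_mulVec]
  ext
  simp [mulVec, dotProduct]

theorem hasCyclicResolution (H : IsRegularTriple z y x) (hz : z ∈ maximalIdeal R)
    (hy : y ∈ maximalIdeal R) (hx : x ∈ maximalIdeal R) {k : ℕ} (hk : 2 ≤ k) (n : ℕ) :
    HasCyclicResolution z k n := by
  induction k, hk using Nat.le_induction with
  | base =>
    rcases eq_or_ne n 0 with rfl | hn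
    · exact ((hasCyclicResolution_zero H hz).succ H hz hy).succ H hz hy
    · exact hasCyclicResolution_base H hz hy hx hn
  | succ k _ ih => exact ih.succ H hz hy

theorem exists_isMinimalResolution (H : IsRegularTriple z y x) (hz : z ∈ maximalIdeal R)
    (hy : y ∈ maximalIdeal R) (hx : x ∈ maximalIdeal R) {k : ℕ} (hk : 2 ≤ k) (n m : ℕ) :
    ∃ (ι₀ ι₁ ι₂ ι₃ : Type) (_ : Fintype ι₀) (_ : Fintype ι₁) (_ : Fintype ι₂) (_ : Fintype ι₃)
      (d₁ : Matrix ι₀ ι₁ R) (d₂ : Matrix ι₁ ι₂ R) (d₃ : Matrix ι₂ ι₃ R),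
      Fintype.card ι₀ = m + 1 ∧ Fintype.card ι₁ = m + 1 + k ∧ Fintype.card ι₂ = k + n ∧
        Fintype.card ι₃ = n ∧ IsMinimalResolution d₁ d₂ d₃ (m + 1) k n := by
  induction m with
  | zero =>
    obtain ⟨ι₁, ι₂, ι₃, _, _, _, d₁, d₂, d₃, c₁, c₂, c₃, h, -⟩ :=
      hasCyclicResolution H hz hy hx hk n
    exact ⟨Unit, ι₁, ι₂, ι₃, inferInstance, inferInstance, inferInstance, inferInstance,
      d₁, d₂, d₃, by simp, by simpa using c₁, c₂, c₃, by simpa using h⟩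
  | succ m ih =>
    obtain ⟨ι₀, ι₁, ι₂, ι₃, _, _, _, _, d₁, d₂, d₃, c₀, c₁, c₂, c₃, h⟩ := ih
    exact ⟨ι₀ ⊕ Unit, ι₁ ⊕ Unit, ι₂, ι₃, inferInstance, inferInstance, inferInstance,
      inferInstance, _, _, _, by simp [c₀], by simp [c₁]; omega, c₂, c₃,
      h.directSum H.z_mem_nonZeroDivisors hz⟩

end Existence

theorem corollary12p2 {R : Type*} [CommRing R] [IsLocalRing R] [IsNoetherianRing R]
    (hdepth : 3 ≤ localDepth R)
    (φ : Format) (hχ : φ.eulerChar = 0) (hf₀ : 0 < φ.f₀) (hr₂ : 1 < φ.r₂) :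
    ∃ F : FreeComplex R φ.f₀ φ.f₁ φ.f₂ φ.f₃,
      F.HasFormat φ ∧ F.IsAcyclic ∧ F.IsMinimal := by
  obtain ⟨r₀, r₁, r₂, r₃⟩ := φ
  have hr₀ : r₀ = 0 := by
    simp only [Format.eulerChar, Format.f₀, Format.f₁, Format.f₂, Format.f₃] at hχ
    push_cast at hχ
    omega
  subst hr₀
  simp only [Format.f₀, Format.f₁, Format.f₂, Format.f₃] at hf₀ hr₂ ⊢
  obtain ⟨m, rfl⟩ : ∃ m, r₁ = m + 1 := ⟨r₁ - 1, by omega⟩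
  obtain ⟨z, y, x, hz, hy, hx, H⟩ := exists_isRegularTriple hdepth
  obtain ⟨ι₀, ι₁, ι₂, ι₃, _, _, _, _, d₁, d₂, d₃, c₀, c₁, c₂, c₃, h⟩ :=
    exists_isMinimalResolution H hz hy hx hr₂ r₃ m
  replace h := h.reindex (Fintype.equivFinOfCardEq (c₀.trans (zero_add _).symm)).symm
    (Fintype.equivFinOfCardEq c₁).symm (Fintype.equivFinOfCardEq c₂).symm
    (Fintype.equivFinOfCardEq c₃).symm
  refine ⟨⟨_, _, _, h.d₁_mul_d₂, h.d₂_mul_d₃⟩, ⟨?_, ?_, ?_⟩, ⟨?_, ?_, ?_⟩,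
    ⟨h.min₁, h.min₂, h.min₃⟩⟩
  · refine hasMinorRank_of_hasRegularMinor h.minor₁ fun k a _ _ => ?_
    simpa [Format.f₀] using Fintype.card_le_of_embedding a
  · refine hasMinorRank_of_hasRegularMinor h.minor₂ fun k a b hab => ?_
    simpa using card_le_of_det_submatrix_ne_zero h.d₁_mul_d₂ (by simpa using h.minor₁)
      (by simp) hab
  · refine hasMinorRank_of_hasRegularMinor h.minor₃ fun k _ b _ => ?_
    have := Fintype.card_le_of_embedding b
    rwa [Fintype.card_fin, Fintype.card_fin] at this
  · refine fun u => ⟨h.exact₁ u, ?_⟩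
    rintro ⟨v, rfl⟩
    simp [h.d₁_mul_d₂]
  · refine fun v => ⟨h.exact₂ v, ?_⟩
    rintro ⟨w, rfl⟩
    simp [h.d₂_mul_d₃]
  · exact (injective_iff_map_eq_zero _).2 h.exact₃
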